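/- **Model.** Let $n>2$ and $1\le f<n$. Processes $0,\dots,n-1$ with initial values $v_i\in\{0,1\}$ run a deterministic protocol in synchronous rounds; round $m+1$ takes place between time $m$ and time $m+1$, and messages sent at time $m$ (in round $m+1$) arrive by time $m+1$. A faulty process crashes in some round $m\ge1$: it behaves correctly in earlier rounds, in round $m$ it sends an arbitrary subset of the messages prescribed to it, it takes no decision at time $m$ or later, and sends nothing after round $m$. In the context $\gamma^f$ at most $f$ processes fail in a run. A run is *nice* if all $v_i=1$ and no process fails. A protocol *solves atomic commitment (AC) in $\gamma^f$* if in every run in $\gamma^f$: every correct process eventually decides commit or abort (Decision); all processes that decide make the same decision (Agreement); a process decides commit only if all initial values are $1$ (Commit Validity); a process decides abort only if some initial value is $0$ or some process failed (Abort Validity). **Biased consensus.** Let $\mathtt{B.1.Consensus}(f-1,\cdot)$ be a uniform consensus protocol with binary proposals such that in every run in $\gamma^f$ a value is decided only if some process proposed it (Validity) and every correct process eventually decides (Decision), and such that in every run in $\gamma^f$ in which at most $f-1$ processes fail, not counting those that crash at the very start without sending any message, no two processes decide differently (Agreement) and, if some correct process proposes $1$, only $1$ is decided (Biased-to-1). **The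 Stealth protocol** (here "all" includes the sender; a message to oneself is received but is not sent over the network). Round 1: each $i$ with $v_i=1$ sends '1' to process $0$. Round 2: process $0$, if it received '1' from all, sends $\mathtt{all[1]}$ to $0,1,\dots,f$. Round 3: each of $0,\dots,f$ that received no message from process $0$ in round 2 sends 'err' to all. Time 3 / round 4: a process that received no 'err' in round 3 commits (at time 3); every other process sends 'huh?' to all. Time 4 / round 5 on: a process that received no 'huh?' in round 4 halts. Every other process takes part in $\mathtt{B.1.Consensus}(f-1,\hat v_i)$, which starts at time 4, with $\hat v_i=1$ if it received $\mathtt{all[1]}$ or has committed and $\hat v_i=0$ otherwise; if it has not committed, it then commits if the consensus decision is $1$ and aborts if it is $0$. **Claim.** 1. Protocols $\mathtt{B.1.Consensus}(f-1,\cdot)$ as above exist, even such that every correct process decides within $f$ rounds in every run in $\gamma^f$. 2. With any such protocol, Stealth solves AC in $\gamma^f$, and in each of its nice runs exactly $n+f-1$ messages are sent over the network, and every process commits at time 3 (and takes no decision at any other time). 3. This matches the lower bound: if $f>1$, and a protocol that solves AC in $\gamma^f$ sends exactly $n+f-1$ messages over the network in its nice run, where all processes have decided by time $D$, then $D\ge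 3$. -/

import Mathlib

/-- The messages received by a process in each of the rounds `1, 2, …, m`, in this order; each
round is given as a map from senders to messages (`none`: no message was received). Its length is
the current time `m`. Together with the process's identity and initial value this is the local
state: what the process has sent and decided so far is determined by it. -/
abbrev History (n : ℕ) (M : Type*) := List (Fin n → Option M)

/-- The message received from `j` in round `k ≥ 1`. -/
def received {n : ℕ} {M : Type*} (h : History n M) (k : ℕ) (j : Fin n) : Option M :=
  (h[k - 1]?).bind fun μ => μ j

/-- A deterministic protocol for processes `0, …, n-1` with binary initial values, messages in `M`
and decisions in `D`. At time `m`, as a function of the local state, it prescribes the message (if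
any) that is sent to each process in round `m + 1`, and the decision (if any) taken at time `m`.
A message to oneself is a local step; it does not travel over the network. -/
structure Protocol (n : ℕ) (M : Type*) (D : Type*) where
  send : Fin n → Bool → History n M → Fin n → Option M
  decide : Fin n → Bool → History n M → Option D

/-- The data that determine a run of a deterministic protocol in the synchronous crash model: the
initial values and the failure pattern. Process `i` is correct if `crashTime i = ⊤`. If
`crashTime i = c` is finite, `i` crashes in round `c + 1`, that is, between time `c` and time
`c + 1`; of the messages prescribed for that round, those to the members of `reach i` are sent. -/
structure Run (n : ℕ) where
  init : Fin n → Bool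
  crashTime : Fin n → ℕ∞
  reach : Fin n → Set (Fin n)

namespace Run

variable {n : ℕ}

def Correct (r : Run n) (i : Fin n) : Prop := r.crashTime i = ⊤

def faulty (r : Run n) : Set (Fin n) := {i | ¬ r.Correct i}

/-- The run belongs to the context `γ^f`: at most `f` processes fail. -/
def InContext (r : Run n) (f : ℕ) : Prop := r.faulty.ncard ≤ f

/-- All initial values are `1` and no process fails. -/
def IsNice (r : Run n) : Prop := (∀ i, r.init i = true) ∧ ∀ i, r.Correct i

/-- The message (if any) prescribed for `i` to `j` in round `m + 1` is really sent. -/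
def Transmits (r : Run n) (i : Fin n) (m : ℕ) (j : Fin n) : Prop :=
  (m : ℕ∞) < r.crashTime i ∨ ((m : ℕ∞) = r.crashTime i ∧ j ∈ r.reach i)

/-- The process crashes at the very start: it never sends a message, and so takes no part. -/
def Absent (r : Run n) (i : Fin n) : Prop := r.crashTime i = 0 ∧ r.reach i = ∅

end Run

namespace Protocol

variable {n : ℕ} {M D : Type*}

open Classical in
/-- The history of each process at time `m` in the run `r` of `P`. -/
noncomputable def history (P : Protocol n M D) (r : Run n) : ℕ → Fin n → History n M
  | 0, _ => []
  | m + 1, i => P.history r m i ++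
      [fun j => if r.Transmits j m i then P.send j (r.init j) (P.history r m j) i else none]

/-- Process `i` decides `d` at time `m` in the run `r` of `P`. A process that crashes in round
`c + 1` may decide at the times `0, …, c`, and not at time `c + 1` or later. -/
def DecidesAt (P : Protocol n M D) (r : Run n) (i : Fin n) (m : ℕ) (d : D) : Prop :=
  (m : ℕ∞) ≤ r.crashTime i ∧ P.decide i (r.init i) (P.history r m i) = some d

def Decides (P : Protocol n M D) (r : Run n) (i : Fin n) (d : D) : Prop :=
  ∃ m, P.DecidesAt r i m d

/-- The messages sent over the network in the run `r` of `P`: `(m, i, j)` stands for the message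
from `i` to `j ≠ i` that is sent at time `m`, in round `m + 1`. -/
def networkMessages (P : Protocol n M D) (r : Run n) : Set (ℕ × Fin n × Fin n) :=
  {x | x.2.1 ≠ x.2.2 ∧ r.Transmits x.2.1 x.1 x.2.2 ∧
    P.send x.2.1 (r.init x.2.1) (P.history r x.1 x.2.1) x.2.2 ≠ none}

end Protocol

inductive ACDecision
  | commit
  | abort

/-- `P` solves atomic commitment in `γ^f`. -/
structure SolvesAC {n : ℕ} {M : Type*} (P : Protocol n M ACDecision) (f : ℕ) : Prop where
  decision : ∀ r : Run n, r.InContext f → ∀ i, r.Correct i → ∃ d, P.Decides r i d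
  agreement : ∀ r : Run n, r.InContext f →
    ∀ i j d d', P.Decides r i d → P.Decides r j d' → d = d'
  commit_validity : ∀ r : Run n, r.InContext f →
    ∀ i, P.Decides r i ACDecision.commit → ∀ j, r.init j = true
  abort_validity : ∀ r : Run n, r.InContext f →
    ∀ i, P.Decides r i ACDecision.abort → (∃ j, r.init j = false) ∨ ∃ j, ¬ r.Correct j

/-- `C` is a biased-to-1 uniform consensus protocol for at most `t` crashes among the processes
that take part, where the initial values are the proposals and at most `t + 1` processes fail
altogether. Agreement and the bias to `1` are required if at most `t` of the processes that take
part fail (a process that has crashed before the start takes no part); validity and decision are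
required in any case. -/
structure SolvesB1Consensus {n : ℕ} {M : Type*} (C : Protocol n M Bool) (t : ℕ) : Prop where
  validity : ∀ r : Run n, r.InContext (t + 1) →
    ∀ i d, C.Decides r i d → ∃ j, r.init j = d
  decision : ∀ r : Run n, r.InContext (t + 1) → ∀ i, r.Correct i → ∃ d, C.Decides r i d
  agreement : ∀ r : Run n, r.InContext (t + 1) → {i ∈ r.faulty | ¬ r.Absent i}.ncard ≤ t →
    ∀ i j d d', C.Decides r i d → C.Decides r j d' → d = d'
  biased_to_one : ∀ r : Run n, r.InContext (t + 1) → {i ∈ r.faulty | ¬ r.Absent i}.ncard ≤ t →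
    (∃ j, r.Correct j ∧ r.init j = true) → ∀ i d, C.Decides r i d → d = true

/-- The messages of the Stealth protocol; `cons x` carries the message `x` of the consensus
protocol. -/
inductive StealthMsg (M : Type*)
  | one
  | allOne
  | err
  | huh
  | cons (x : M)

namespace Stealth

variable {n : ℕ} {M : Type*}

/-- The process received `all[1]` from process `0` in round 2. -/
def GotAllOne (h : History n (StealthMsg M)) : Prop :=
  ∃ z : Fin n, (z : ℕ) = 0 ∧ received h 2 z = some .allOne

/-- The process received some error message in round 3. If not, it commits at time 3. -/
def GotErr (h : History n (StealthMsg M)) : Prop := ∃ k, received h 3 k = some .err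

/-- The process received some `huh?` message in round 4. If not, it halts at time 4. -/
def GotHuh (h : History n (StealthMsg M)) : Prop := ∃ k, received h 4 k = some .huh

open Classical in
/-- The value with which a process enters the consensus protocol: `1` if it received `all[1]` or
performed commit, and `0` otherwise. -/
noncomputable def proposal (h : History n (StealthMsg M)) : Bool :=
  if GotAllOne h ∨ ¬ GotErr h then true else false

def consPart : StealthMsg M → Option M
  | .cons x => some x
  | _ => none

/-- The history of the consensus protocol, which starts at time 4 (in round 5). -/
def consHistory (h : History n (StealthMsg M)) : History n M :=
  (h.drop 4).map fun μ j => (μ j).bind consPart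

open Classical in
/-- The message prescribed for `i` to `j` in round `h.length + 1`. -/
noncomputable def send (f : ℕ) (C : Protocol n M Bool) (i : Fin n) (v : Bool)
    (h : History n (StealthMsg M)) (j : Fin n) : Option (StealthMsg M) :=
  match h.length with
  | 0 => if v = true ∧ (j : ℕ) = 0 then some .one else none
  | 1 => if (i : ℕ) = 0 ∧ (∀ k, received h 1 k = some .one) ∧ (j : ℕ) ≤ f then some .allOne
      else none
  | 2 => if (i : ℕ) ≤ f ∧ (∀ z : Fin n, (z : ℕ) = 0 → received h 2 z = none) then some .err
      else none
  | 3 => if GotErr h then some .huh else none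
  | _ + 4 => if GotHuh h then (C.send i (proposal h) (consHistory h) j).map .cons else none

def ofBool : Bool → ACDecision
  | true => .commit
  | false => .abort

open Classical in
/-- The decision prescribed at time `h.length`. -/
noncomputable def decide (C : Protocol n M Bool) (i : Fin n) (_v : Bool)
    (h : History n (StealthMsg M)) : Option ACDecision :=
  match h.length with
  | 0 | 1 | 2 => none
  | 3 => if GotErr h then none else some .commit
  | _ + 4 => if GotHuh h ∧ GotErr h then (C.decide i (proposal h) (consHistory h)).map ofBool
      else none

end Stealth

/-- The Stealth protocol for at most `f` crashes, with `C` as its consensus protocol. -/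
noncomputable def stealth {n : ℕ} {M : Type*} (f : ℕ) (C : Protocol n M Bool) :
    Protocol n (StealthMsg M) ACDecision where
  send := Stealth.send f C
  decide := Stealth.decide C

/-! ### Transmission, histories and indistinguishable runs. -/

namespace Run

variable {n : ℕ}

/-! Existence of the consensus protocol: flood the value `1` for `f` rounds. With at most `f - 1`
participating crashes some round is clean, and after it the live processes agree on whether a `1`
exists (`Flooding.InformedAt.spread`).

Correctness of Stealth: one of `0, …, f` is correct. If a process sees no error, that correct
process must have received `all[1]`, so all values are `1` and somebody correct proposes `1`. If an
error is seen although all values are `1`, some process crashed before time 4; it is absent from the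
consensus, which thus faces at most `f - 1` participating failures and has agreement and the bias to
`1` (`Stealth.ncard_participating_faulty_le`). A process alive at time 4 that saw an error has drawn
everyone in with `huh?`, so a genuine run of the consensus protocol is embedded
(`Stealth.consHistory_eq`).

Lower bound: suppose everybody decides by time 2. By indistinguishability each `j` reaches at least
`f` processes in round 1, itself included (`Protocol.le_ncard_firstReach`), and more than `f` if
some `i` hears from `j` neither directly nor through a relay (`Protocol.lt_ncard_firstReach`). With
`n + f - 1` messages the first bound leaves only `f = 2`. Then `n` of the `n + 1` messages are
needed in round 1, and the one to spare cannot supply all the relays. -/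

theorem Correct.transmits {r : Run n} {i : Fin n} (h : r.Correct i) (m : ℕ) (j : Fin n) :
    r.Transmits i m j := Or.inl (by rw [h]; exact ENat.natCast_lt_top m)

theorem Correct.le_crashTime {r : Run n} {i : Fin n} (h : r.Correct i) (m : ℕ) :
    (m : ℕ∞) ≤ r.crashTime i := by rw [h]; exact le_top

theorem Transmits.le {r : Run n} {i : Fin n} {m : ℕ} {j : Fin n} (h : r.Transmits i m j) :
    (m : ℕ∞) ≤ r.crashTime i := h.elim le_of_lt fun h => h.1.le

/-- A process that is not crashed at time `k` has sent everything prescribed before. -/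
theorem transmits_of_lt_of_le {r : Run n} {i : Fin n} {m k : ℕ} (hmk : m < k)
    (h : (k : ℕ∞) ≤ r.crashTime i) (j : Fin n) : r.Transmits i m j :=
  Or.inl (lt_of_lt_of_le (by exact_mod_cast hmk) h)

end Run

namespace Protocol

variable {n : ℕ} {M D : Type*}

open Classical in
/-- The message that arrives at `i` from `j` in round `m + 1`. -/
noncomputable def delivered (P : Protocol n M D) (r : Run n) (m : ℕ) (j i : Fin n) : Option M :=
  if r.Transmits j m i then P.send j (r.init j) (P.history r m j) i else none

theorem history_succ (P : Protocol n M D) (r : Run n) (m : ℕ) (i : Fin n) :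
    P.history r (m + 1) i = P.history r m i ++ [fun j => P.delivered r m j i] := rfl

@[simp]
theorem length_history (P : Protocol n M D) (r : Run n) (m : ℕ) (i : Fin n) :
    (P.history r m i).length = m := by
  induction m with
  | zero => rfl
  | succ m ih => simp [history_succ, ih]

theorem getElem?_history (P : Protocol n M D) (r : Run n) {m k : ℕ} (hk : k < m) (i : Fin n) :
    (P.history r m i)[k]? = some fun j => P.delivered r k j i := by
  induction m with
  | zero => omega
  | succ m ih =>
    rw [history_succ]
    rcases Nat.lt_succ_iff_lt_or_eq.mp hk with h | rfl
    · rw [List.getElem?_append_left (by simpa using h), ih h]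
    · simp

theorem received_history (P : Protocol n M D) (r : Run n) {m k : ℕ} (hk : k < m) (i j : Fin n) :
    received (P.history r m i) (k + 1) j = P.delivered r k j i := by
  simp [received, getElem?_history P r hk]

theorem take_history (P : Protocol n M D) (r : Run n) {k m : ℕ} (hk : k ≤ m) (i : Fin n) :
    (P.history r m i).take k = P.history r k i := by
  induction m with
  | zero => obtain rfl : k = 0 := by omega
            rfl
  | succ m ih =>
    rcases Nat.le_succ_iff.mp hk with h | rfl
    · rw [history_succ, List.take_append_of_le_length (by simpa using h), ih h]
    · exact List.take_of_length_le (by simp)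

/-- Histories only grow, so a comparison at time 2 also covers decisions taken earlier. -/
theorem history_eq_of_le (P : Protocol n M D) {r s : Run n} {m k : ℕ} (hk : k ≤ m) {i : Fin n}
    (h : P.history r m i = P.history s m i) : P.history r k i = P.history s k i := by
  rw [← take_history P r hk, ← take_history P s hk, h]

theorem history_succ_congr (P : Protocol n M D) {r s : Run n} {m : ℕ} {i : Fin n}
    (h : P.history r m i = P.history s m i)
    (hd : ∀ j, P.delivered r m j i = P.delivered s m j i) :
    P.history r (m + 1) i = P.history s (m + 1) i := by
  rw [history_succ, history_succ, h]
  simp only [hd]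

theorem delivered_of_transmits (P : Protocol n M D) {r : Run n} {m : ℕ} {j i : Fin n}
    (h : r.Transmits j m i) :
    P.delivered r m j i = P.send j (r.init j) (P.history r m j) i := if_pos h

theorem delivered_of_not_transmits (P : Protocol n M D) {r : Run n} {m : ℕ} {j i : Fin n}
    (h : ¬ r.Transmits j m i) : P.delivered r m j i = none := if_neg h

theorem delivered_eq_some_iff (P : Protocol n M D) {r : Run n} {m : ℕ} {j i : Fin n} {x : M} :
    P.delivered r m j i = some x ↔
      r.Transmits j m i ∧ P.send j (r.init j) (P.history r m j) i = some x := by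
  simp [delivered]

/-- Two runs deliver the same message if the sender is in the same state and transmits alike. -/
theorem delivered_congr (P : Protocol n M D) {r s : Run n} {m : ℕ} {j i : Fin n}
    (ht : r.Transmits j m i ↔ s.Transmits j m i) (hi : r.init j = s.init j)
    (h : P.history r m j = P.history s m j) : P.delivered r m j i = P.delivered s m j i := by
  by_cases hr : r.Transmits j m i
  · rw [delivered_of_transmits P hr, delivered_of_transmits P (ht.1 hr), hi, h]
  · rw [delivered_of_not_transmits P hr, delivered_of_not_transmits P (mt ht.2 hr)]

end Protocol

/-! ### A biased consensus protocol by flooding. -/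

namespace Flooding

variable {n : ℕ}

/-- The process started with `1` or has received a message. -/
def Informed (v : Bool) (h : History n Unit) : Prop :=
  v = true ∨ ∃ μ ∈ h, ∃ j, μ j = some ()

open Classical in
/-- Informed processes inform everyone in every round; decisions are taken at time `f`. -/
noncomputable def protocol (n f : ℕ) : Protocol n Unit Bool where
  send _ v h _ := if Informed v h then some () else none
  decide _ v h := if h.length = f then some (if Informed v h then true else false) else none

/-- The process `i` is informed at time `m`. -/
def InformedAt (f : ℕ) (r : Run n) (m : ℕ) (i : Fin n) : Prop :=
  Informed (r.init i) ((protocol n f).history r m i)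

theorem delivered_eq_some (f : ℕ) (r : Run n) (m : ℕ) (j i : Fin n) :
    (protocol n f).delivered r m j i = some () ↔ r.Transmits j m i ∧ InformedAt f r m j := by
  rw [Protocol.delivered_eq_some_iff]
  simp [protocol, InformedAt]

theorem informedAt_zero (f : ℕ) (r : Run n) (i : Fin n) :
    InformedAt f r 0 i ↔ r.init i = true := by
  simp [InformedAt, Informed, Protocol.history]

/-- Replaces the scan of the history by a recursion in time; the later arguments use only this. -/
theorem informedAt_succ (f : ℕ) (r : Run n) (m : ℕ) (i : Fin n) :
    InformedAt f r (m + 1) i ↔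
      InformedAt f r m i ∨ ∃ j, r.Transmits j m i ∧ InformedAt f r m j := by
  simp only [← delivered_eq_some]
  simp only [InformedAt, Informed, Protocol.history_succ, List.mem_append, List.mem_singleton]
  constructor
  · rintro (h | ⟨μ, h | rfl, j, hj⟩)
    · exact .inl (.inl h)
    · exact .inl (.inr ⟨μ, h, j, hj⟩)
    · exact .inr ⟨j, hj⟩
  · rintro ((h | ⟨μ, h, j, hj⟩) | ⟨j, hj⟩)
    · exact .inl h
    · exact .inr ⟨μ, .inl h, j, hj⟩
    · exact .inr ⟨_, .inr rfl, j, hj⟩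

theorem InformedAt.mono {f : ℕ} {r : Run n} {m k : ℕ} (hmk : m ≤ k) {i : Fin n}
    (h : InformedAt f r m i) : InformedAt f r k i := by
  induction hmk with
  | refl => exact h
  | step _ ih => exact (informedAt_succ ..).2 (.inl ih)

theorem InformedAt.exists_init {f : ℕ} {r : Run n} {m : ℕ} {i : Fin n}
    (h : InformedAt f r m i) : ∃ j, r.init j = true := by
  induction m generalizing i with
  | zero => exact ⟨i, (informedAt_zero ..).1 h⟩
  | succ m ih =>
    rcases (informedAt_succ ..).1 h with h | ⟨j, -, h⟩
    exacts [ih h, ih h]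

theorem decidesAt_iff (f : ℕ) (r : Run n) (i : Fin n) (m : ℕ) (d : Bool) :
    (protocol n f).DecidesAt r i m d ↔
      (m : ℕ∞) ≤ r.crashTime i ∧ m = f ∧ (d = true ↔ InformedAt f r f i) := by
  unfold Protocol.DecidesAt
  refine and_congr_right fun _ => ?_
  by_cases hm : m = f
  · subst hm
    by_cases h : InformedAt m r m i
    · have h' := h
      unfold InformedAt at h'
      cases d <;> simp [protocol, h] <;> simpa [protocol] using h'
    · have h' := h
      unfold InformedAt at h'
      cases d <;> simp [protocol, h] <;> simpa [protocol] using h'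
  · simp [protocol, hm]

theorem decides_iff (f : ℕ) (r : Run n) (i : Fin n) (d : Bool) :
    (protocol n f).Decides r i d ↔
      (f : ℕ∞) ≤ r.crashTime i ∧ (d = true ↔ InformedAt f r f i) := by
  simp only [Protocol.Decides, decidesAt_iff]
  constructor
  · rintro ⟨m, h, rfl, h'⟩
    exact ⟨h, h'⟩
  · rintro ⟨h, h'⟩
    exact ⟨f, h, rfl, h'⟩

/-- Among `f` rounds there is one in which no participating process crashes. -/
theorem exists_clean_round {f : ℕ} (hf : 1 ≤ f) {r : Run n}
    (h : {i ∈ r.faulty | ¬ r.Absent i}.ncard ≤ f - 1) :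
    ∃ m < f, ∀ i, r.crashTime i = m → r.Absent i := by
  by_contra! hc
  have : Nonempty (Fin n) := ⟨(hc 0 hf).choose⟩
  -- Otherwise each of the `f` rounds has its own participating process that crashes in it, too many
  -- for the bound `f - 1`.
  choose! g hg ha using hc
  have hinj : Set.InjOn g (Set.Iio f) := by
    intro a ha b hb hab
    have := (hg a ha).symm.trans ((congrArg r.crashTime hab).trans (hg b hb))
    exact_mod_cast this
  have hsub : g '' Set.Iio f ⊆ {i ∈ r.faulty | ¬ r.Absent i} := by
    rintro _ ⟨m, hm, rfl⟩
    refine ⟨?_, ha m hm⟩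
    simp [Run.faulty, Run.Correct, hg m hm]
  have h1 := Set.ncard_le_ncard hsub (Set.toFinite _)
  rw [hinj.ncard_image] at h1
  have h2 : (Set.Iio f).ncard = f := by
    rw [← Finset.coe_Iio, Set.ncard_coe_finset, Nat.card_Iio]
  omega

/-- After a clean round, all processes that are still alive are informed if one of them is. -/
theorem InformedAt.spread {f : ℕ} {r : Run n} {m : ℕ}
    (hm : ∀ i, r.crashTime i = m → r.Absent i) {k : ℕ} (hk : m + 1 ≤ k) {i : Fin n}
    (h : InformedAt f r k i) (hi : (k : ℕ∞) ≤ r.crashTime i) (j : Fin n) :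
    InformedAt f r k j := by
  induction k, hk using Nat.le_induction generalizing i j with
  | base =>
    rcases (informedAt_succ ..).1 h with h | ⟨a, ha, h⟩
    · exact (informedAt_succ ..).2
        (.inr ⟨i, Run.transmits_of_lt_of_le (Nat.lt_succ_self m) hi j, h⟩)
    · rcases ha with ha | ⟨ha, ha'⟩
      · exact (informedAt_succ ..).2 (.inr ⟨a, .inl ha, h⟩)
      -- A sender that crashes in the clean round is absent, hence reaches nobody.
      · simp [(hm a ha.symm).2] at ha'
  | succ k hk ih =>
    rcases (informedAt_succ ..).1 h with h | ⟨a, ha, h⟩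
    · exact (ih h (le_trans (by exact_mod_cast Nat.le_succ k) hi) j).mono (Nat.le_succ k)
    · exact (ih h ha.le j).mono (Nat.le_succ k)

/-- Agreement comes from the clean round. The bias needs only round 1, in which a correct proposer
of `1` informs everyone; this is where `1 ≤ f` enters. -/
theorem solvesB1Consensus {f : ℕ} (hf : 1 ≤ f) : SolvesB1Consensus (protocol n f) (f - 1) where
  validity r _ i d h := by
    obtain ⟨-, h⟩ := (decides_iff ..).1 h
    cases d with
    | true => exact (h.1 rfl).exists_init
    | false =>
      refine ⟨i, ?_⟩
      by_contra hi
      have := h.2 (((informedAt_zero f r i).2 (by simpa using hi)).mono (Nat.zero_le f))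
      simp at this
  decision r _ i hi := by
    classical
    exact ⟨decide (InformedAt f r f i),
      (decides_iff ..).2 ⟨hi.le_crashTime f, by simp⟩⟩
  agreement r _ ht i j d d' h h' := by
    obtain ⟨hi, h⟩ := (decides_iff ..).1 h
    obtain ⟨hj, h'⟩ := (decides_iff ..).1 h'
    obtain ⟨m, hm, hclean⟩ := exists_clean_round hf ht
    have : InformedAt f r f i ↔ InformedAt f r f j :=
      ⟨fun h => h.spread hclean hm hi j, fun h => h.spread hclean hm hj i⟩
    rw [Bool.eq_iff_iff, h, h', this]
  biased_to_one r _ _ := by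
    rintro ⟨j, hj, hv⟩ i d h
    obtain ⟨-, h⟩ := (decides_iff ..).1 h
    refine h.2 (InformedAt.mono hf ?_)
    exact (informedAt_succ ..).2 (.inr ⟨j, hj.transmits 0 i, (informedAt_zero ..).2 hv⟩)

theorem exists_decidesAt (f : ℕ) {r : Run n} {i : Fin n} (hi : r.Correct i) :
    ∃ m ≤ f, ∃ d, (protocol n f).DecidesAt r i m d := by
  classical
  exact ⟨f, le_rfl, decide (InformedAt f r f i),
    (decidesAt_iff ..).2 ⟨hi.le_crashTime f, rfl, by simp⟩⟩

end Flooding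

/-! ### Stealth in terms of initial values and failures. -/

namespace Stealth

variable {n : ℕ} {M : Type*}

/-- In the run `r`, process `0` receives `1` from all in round 1, and its message `all[1]` reaches
the process `i` in round 2. -/
def AllOneReaches (f : ℕ) (r : Run n) (i : Fin n) : Prop :=
  ∃ z : Fin n, (z : ℕ) = 0 ∧ r.Transmits z 1 i ∧ (∀ k, r.Transmits k 0 z ∧ r.init k = true) ∧
    (i : ℕ) ≤ f

/-- In the run `r`, some error message reaches `i` in round 3. -/
def ErrReaches (f : ℕ) (r : Run n) (i : Fin n) : Prop :=
  ∃ k : Fin n, r.Transmits k 2 i ∧ (k : ℕ) ≤ f ∧ ¬ AllOneReaches f r k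

/-- In the run `r`, some `huh?` message reaches `i` in round 4. -/
def HuhReaches (f : ℕ) (r : Run n) (i : Fin n) : Prop :=
  ∃ k : Fin n, r.Transmits k 3 i ∧ ErrReaches f r k

open Classical in
/-- The value with which `i` would enter the consensus protocol in the run `r`. -/
noncomputable def entryValue (f : ℕ) (r : Run n) (i : Fin n) : Bool :=
  if AllOneReaches f r i ∨ ¬ ErrReaches f r i then true else false

section Messages

variable (f : ℕ) (C : Protocol n M Bool) (r : Run n)

theorem send_zero (i : Fin n) (v : Bool) (j : Fin n) [Decidable (v = true ∧ (j : ℕ) = 0)] :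
    (stealth f C).send i v ((stealth f C).history r 0 i) j =
      if v = true ∧ (j : ℕ) = 0 then some .one else none := by
  simp only [stealth, send, Protocol.length_history]
  congr

theorem received_one_iff {m : ℕ} (hm : 1 ≤ m) (z k : Fin n) (hz : (z : ℕ) = 0) :
    received ((stealth f C).history r m z) 1 k = some .one ↔
      r.Transmits k 0 z ∧ r.init k = true := by
  classical
  rw [Protocol.received_history _ _ hm, Protocol.delivered_eq_some_iff, send_zero]
  simp [hz]

theorem send_one (i : Fin n) (v : Bool) (j : Fin n)
    [Decidable ((i : ℕ) = 0 ∧ (∀ k, r.Transmits k 0 i ∧ r.init k = true) ∧ (j : ℕ) ≤ f)] :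
    (stealth f C).send i v ((stealth f C).history r 1 i) j =
      if (i : ℕ) = 0 ∧ (∀ k, r.Transmits k 0 i ∧ r.init k = true) ∧ (j : ℕ) ≤ f
      then some .allOne else none := by
  have hiff : ((i : ℕ) = 0 ∧
      (∀ k, received ((stealth f C).history r 1 i) 1 k = some .one) ∧ (j : ℕ) ≤ f) ↔
      ((i : ℕ) = 0 ∧ (∀ k, r.Transmits k 0 i ∧ r.init k = true) ∧ (j : ℕ) ≤ f) :=
    and_congr_right fun hi =>
      and_congr_left' (forall_congr' fun k => received_one_iff f C r le_rfl i k hi)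
  have hlen := Protocol.length_history (stealth f C) r 1 i
  -- `stealth` also occurs inside the history, so the auxiliary facts are unfolded in the same way
  -- to keep matching the goal.
  simp only [stealth, send] at hlen hiff ⊢
  rw [hlen]
  simp only [hiff]

theorem received_two {m : ℕ} (hm : 2 ≤ m) (i z : Fin n) (hz : (z : ℕ) = 0)
    [Decidable (AllOneReaches f r i)] :
    received ((stealth f C).history r m i) 2 z =
      if AllOneReaches f r i then some .allOne else none := by
  classical
  have hiff : AllOneReaches f r i ↔ r.Transmits z 1 i ∧
      (∀ k, r.Transmits k 0 z ∧ r.init k = true) ∧ (i : ℕ) ≤ f := by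
    constructor
    · rintro ⟨z', hz', h⟩
      obtain rfl : z' = z := Fin.ext (hz'.trans hz.symm)
      exact h
    · exact fun h => ⟨z, hz, h⟩
  rw [Protocol.received_history _ _ hm, Protocol.delivered, send_one]
  by_cases h : r.Transmits z 1 i <;> simp [hiff, h, hz]

theorem gotAllOne_iff (hn : 0 < n) {m : ℕ} (hm : 2 ≤ m) (i : Fin n) :
    GotAllOne ((stealth f C).history r m i) ↔ AllOneReaches f r i := by
  classical
  constructor
  · rintro ⟨z, hz, h⟩
    rw [received_two f C r hm i z hz] at h
    by_contra hc
    simp [hc] at h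
  · intro h
    exact ⟨⟨0, hn⟩, rfl, by rw [received_two f C r hm i _ rfl, if_pos h]⟩

theorem send_two (hn : 0 < n) (i : Fin n) (v : Bool) (j : Fin n)
    [Decidable ((i : ℕ) ≤ f ∧ ¬ AllOneReaches f r i)] :
    (stealth f C).send i v ((stealth f C).history r 2 i) j =
      if (i : ℕ) ≤ f ∧ ¬ AllOneReaches f r i then some .err else none := by
  classical
  have hiff : ((i : ℕ) ≤ f ∧
      ∀ z : Fin n, (z : ℕ) = 0 → received ((stealth f C).history r 2 i) 2 z = none) ↔
      ((i : ℕ) ≤ f ∧ ¬ AllOneReaches f r i) := by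
    refine and_congr_right fun _ => ⟨fun h hc => ?_, fun h z hz => ?_⟩
    · have := h ⟨0, hn⟩ rfl
      rw [received_two f C r le_rfl i _ rfl, if_pos hc] at this
      simp at this
    · rw [received_two f C r le_rfl i z hz, if_neg h]
  have hlen := Protocol.length_history (stealth f C) r 2 i
  simp only [stealth, send] at hlen hiff ⊢
  rw [hlen]
  simp only [hiff]

theorem gotErr_iff (hn : 0 < n) {m : ℕ} (hm : 3 ≤ m) (i : Fin n) :
    GotErr ((stealth f C).history r m i) ↔ ErrReaches f r i := by
  classical
  refine exists_congr fun k => ?_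
  rw [Protocol.received_history _ _ hm, Protocol.delivered_eq_some_iff, send_two f C r hn]
  simp

theorem proposal_eq (hn : 0 < n) {m : ℕ} (hm : 3 ≤ m) (i : Fin n) :
    proposal ((stealth f C).history r m i) = entryValue f r i := by
  rw [Bool.eq_iff_iff]
  simp [proposal, entryValue, gotAllOne_iff f C r hn (by omega : 2 ≤ m), gotErr_iff f C r hn hm]

theorem send_three (hn : 0 < n) (i : Fin n) (v : Bool) (j : Fin n)
    [Decidable (ErrReaches f r i)] :
    (stealth f C).send i v ((stealth f C).history r 3 i) j =
      if ErrReaches f r i then some .huh else none := by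
  have hlen := Protocol.length_history (stealth f C) r 3 i
  have hiff := gotErr_iff f C r hn le_rfl i
  simp only [stealth, send] at hlen hiff ⊢
  rw [hlen]
  simp only [hiff]

theorem gotHuh_iff (hn : 0 < n) {m : ℕ} (hm : 4 ≤ m) (i : Fin n) :
    GotHuh ((stealth f C).history r m i) ↔ HuhReaches f r i := by
  classical
  refine exists_congr fun k => ?_
  rw [Protocol.received_history _ _ hm, Protocol.delivered_eq_some_iff, send_three f C r hn]
  simp

theorem send_add_four (hn : 0 < n) (m : ℕ) (i : Fin n) (v : Bool) (j : Fin n)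
    [Decidable (HuhReaches f r i)] :
    (stealth f C).send i v ((stealth f C).history r (m + 4) i) j =
      if HuhReaches f r i then
        (C.send i (entryValue f r i)
          (consHistory ((stealth f C).history r (m + 4) i)) j).map .cons
      else none := by
  have hlen := Protocol.length_history (stealth f C) r (m + 4) i
  have hiff := gotHuh_iff f C r hn (Nat.le_add_left 4 m) i
  have hprop := proposal_eq f C r hn (by omega : 3 ≤ m + 4) i
  simp only [stealth, send] at hlen hiff hprop ⊢
  rw [hlen]
  simp only [hiff, hprop]

/-- Up to time 4 everything depends on the failure pattern and the initial values alone; only the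
consensus phase still refers to histories. -/
theorem decidesAt_iff (hn : 0 < n) (i : Fin n) (m : ℕ) (d : ACDecision) :
    (stealth f C).DecidesAt r i m d ↔ (m : ℕ∞) ≤ r.crashTime i ∧
      ((m = 3 ∧ ¬ ErrReaches f r i ∧ d = .commit) ∨
        ∃ k b, m = k + 4 ∧ HuhReaches f r i ∧ ErrReaches f r i ∧ d = ofBool b ∧
          C.decide i (entryValue f r i)
            (consHistory ((stealth f C).history r (k + 4) i)) = some b) := by
  refine and_congr_right fun _ => ?_
  have hlen := Protocol.length_history (stealth f C) r m i
  rcases m with _ | _ | _ | _ | k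
  · simp only [stealth, decide] at hlen ⊢
    rw [hlen]
    simp
  · simp only [stealth, decide] at hlen ⊢
    rw [hlen]
    simp
  · simp only [stealth, decide] at hlen ⊢
    rw [hlen]
    simp
  · have hiff := gotErr_iff f C r hn le_rfl i
    simp only [stealth, decide] at hlen hiff ⊢
    rw [hlen]
    by_cases h : ErrReaches f r i <;> simp [hiff, h, eq_comm]
  · have herr := gotErr_iff f C r hn (by omega : 3 ≤ k + 4) i
    have hhuh := gotHuh_iff f C r hn (Nat.le_add_left 4 k) i
    have hprop := proposal_eq f C r hn (by omega : 3 ≤ k + 4) i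
    simp only [stealth, decide] at hlen herr hhuh hprop ⊢
    rw [hlen]
    simp only [hprop]
    by_cases h : HuhReaches f r i ∧ ErrReaches f r i
    · rw [if_pos ⟨hhuh.2 h.1, herr.2 h.2⟩]
      simp [h, eq_comm, and_comm]
    · rw [if_neg fun hg => h ⟨hhuh.1 hg.1, herr.1 hg.2⟩]
      simp only [reduceCtorEq, false_iff, not_or]
      refine ⟨by omega, ?_⟩
      rintro ⟨_, _, _, h1, h2, _⟩
      exact h ⟨h1, h2⟩

end Messages

/-! ### The embedded run of the consensus protocol. -/

open Classical in
/-- The run of the consensus protocol that is embedded in the run `r` from time 4 on. -/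
noncomputable def consRun (f : ℕ) (r : Run n) : Run n where
  init := entryValue f r
  crashTime i := r.crashTime i - 4
  reach i := if r.crashTime i < 4 then ∅ else r.reach i

/-- Truncated subtraction sends the crash times `0, …, 4` all to `0`. Emptying `reach` below `4`
silences the processes that are already dead, while a crash at time `4` keeps its partial round. -/
theorem consRun_transmits_iff (f : ℕ) (r : Run n) (i : Fin n) (m : ℕ) (j : Fin n) :
    (consRun f r).Transmits i m j ↔ r.Transmits i (m + 4) j := by
  simp only [Run.Transmits, consRun]
  cases h : r.crashTime i with
  | top =>
    have : (⊤ : ℕ∞) - 4 = ⊤ := rfl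
    simp only [this, ENat.natCast_lt_top, true_or]
  | coe c =>
    have e1 : ((c : ℕ∞) - 4) = ((c - 4 : ℕ) : ℕ∞) := by push_cast; rfl
    have e2 : (c : ℕ∞) < 4 ↔ c < 4 := by norm_cast
    rw [e1]
    simp only [Nat.cast_lt, Nat.cast_inj, e2]
    by_cases hc : c < 4
    · simp only [hc, if_true, Set.mem_empty_iff_false, and_false, or_false]
      omega
    · simp only [hc, if_false]
      have : m < c - 4 ↔ m + 4 < c := by omega
      have : m = c - 4 ↔ m + 4 = c := by omega
      simp [*]

theorem consRun_correct_iff (f : ℕ) (r : Run n) (i : Fin n) :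
    (consRun f r).Correct i ↔ r.Correct i := by
  simp only [Run.Correct, consRun]
  cases h : r.crashTime i with
  | top => exact iff_of_true rfl rfl
  | coe c =>
    have e1 : ((c : ℕ∞) - 4) = ((c - 4 : ℕ) : ℕ∞) := by push_cast; rfl
    rw [e1]
    simp

theorem consRun_faulty (f : ℕ) (r : Run n) : (consRun f r).faulty = r.faulty := by
  ext i
  exact not_congr (consRun_correct_iff f r i)

theorem consRun_absent {f : ℕ} {r : Run n} {i : Fin n} (h : r.crashTime i < 4) :
    (consRun f r).Absent i :=
  ⟨by simpa [consRun] using tsub_eq_zero_of_le h.le, by simp [consRun, h]⟩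

theorem le_consRun_crashTime {f : ℕ} {r : Run n} {i : Fin n} {m : ℕ}
    (h : ((m + 4 : ℕ) : ℕ∞) ≤ r.crashTime i) : (m : ℕ∞) ≤ (consRun f r).crashTime i := by
  simp only [consRun]
  refine ENat.le_sub_of_add_le_right (by simp) (by exact_mod_cast h)

/-- A process without `huh?` is silent where `C` might send, so the embedding is faithful only if
`huh?` reaches everyone. -/
theorem consHistory_eq {f : ℕ} (C : Protocol n M Bool) {r : Run n} (hn : 0 < n)
    (hhuh : ∀ i, HuhReaches f r i) (m : ℕ) (i : Fin n) :
    consHistory ((stealth f C).history r (m + 4) i) = C.history (consRun f r) m i := by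
  classical
  induction m generalizing i with
  | zero =>
    simp only [consHistory, Protocol.history]
    simp
  | succ m ih =>
    have e : m + 1 + 4 = (m + 4) + 1 := by omega
    rw [e, Protocol.history_succ _ _ (m + 4), Protocol.history_succ _ _ m, ← ih i]
    simp only [consHistory]
    rw [List.drop_append_of_le_length (by simp), List.map_append]
    simp only [List.map_cons, List.map_nil, List.append_cancel_left_eq, List.cons.injEq, and_true]
    funext j
    by_cases ht : r.Transmits j (m + 4) i
    · rw [Protocol.delivered_of_transmits _ ht,
        Protocol.delivered_of_transmits _ ((consRun_transmits_iff ..).2 ht),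
        send_add_four f C r hn, if_pos (hhuh j), ih j]
      change _ = C.send j (entryValue f r j) (C.history (consRun f r) m j) i
      cases C.send j (entryValue f r j) (C.history (consRun f r) m j) i <;> rfl
    · rw [Protocol.delivered_of_not_transmits _ ht,
        Protocol.delivered_of_not_transmits _ (mt (consRun_transmits_iff ..).1 ht)]
      rfl

/-! ### Stealth solves atomic commitment. -/

section Correctness

variable {f : ℕ} {r : Run n}

/-- At least one of the processes `0, …, f` is correct. -/
theorem exists_correct_le (hfn : f < n) (hr : r.InContext f) :
    ∃ k : Fin n, (k : ℕ) ≤ f ∧ r.Correct k := by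
  by_contra! h
  have hsub : ((Finset.Iic (⟨f, hfn⟩ : Fin n) : Finset (Fin n)) : Set (Fin n)) ⊆ r.faulty :=
    fun k hk => h k (by simpa [Fin.le_def] using hk)
  have := Set.ncard_le_ncard hsub (Set.toFinite _)
  rw [Set.ncard_coe_finset, Fin.card_Iic] at this
  exact absurd (this.trans hr) (by simp)

theorem AllOneReaches.init {i : Fin n} (h : AllOneReaches f r i) (j : Fin n) :
    r.init j = true := by
  obtain ⟨z, -, -, h, -⟩ := h
  exact (h j).2

/-- If no error message reaches some process, then `all[1]` has reached a correct process. -/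
theorem exists_allOneReaches_of_not_errReaches (hfn : f < n) (hr : r.InContext f) {i : Fin n}
    (h : ¬ ErrReaches f r i) : ∃ k, r.Correct k ∧ AllOneReaches f r k := by
  obtain ⟨k, hk, hc⟩ := exists_correct_le hfn hr
  refine ⟨k, hc, ?_⟩
  by_contra hk'
  exact h ⟨k, hc.transmits 2 i, hk, hk'⟩

/-- Both reasons for proposing `1` trace back to an `all[1]` that was actually sent. -/
theorem init_of_entryValue (hfn : f < n) (hr : r.InContext f) {i : Fin n}
    (h : entryValue f r i = true) (j : Fin n) : r.init j = true := by
  simp only [entryValue, ite_eq_left_iff, Bool.false_eq_true, imp_false, not_not] at h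
  rcases h with h | h
  · exact h.init j
  · obtain ⟨k, -, hk⟩ := exists_allOneReaches_of_not_errReaches hfn hr h
    exact hk.init j

theorem huhReaches_of_errReaches {i : Fin n} (hi : (4 : ℕ∞) ≤ r.crashTime i)
    (h : ErrReaches f r i) (j : Fin n) : HuhReaches f r j :=
  ⟨i, Run.transmits_of_lt_of_le (k := 4) (by omega) hi j, h⟩

/-- If all initial values are `1` and some error message is received, then at most `f - 1` of the
processes that take part in the consensus protocol fail. -/
theorem ncard_participating_faulty_le (hn : 0 < n) (hr : r.InContext f)
    (hv : ∀ j, r.init j = true) {i : Fin n} (h : ErrReaches f r i) :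
    {j ∈ (consRun f r).faulty | ¬ (consRun f r).Absent j}.ncard ≤ f - 1 := by
  -- Without such a crash, `all[1]` would reach all of `0, …, f`, and nobody would send `err`.
  obtain ⟨j, hj⟩ : ∃ j, r.crashTime j < 4 := by
    by_contra! hc
    obtain ⟨k, -, hk, h⟩ := h
    refine h ⟨⟨0, hn⟩, rfl, Run.transmits_of_lt_of_le (k := 4) (by omega) (hc _) k,
      fun l => ⟨Run.transmits_of_lt_of_le (k := 4) (by omega) (hc l) _, hv l⟩, hk⟩
  have hjf : j ∈ r.faulty := fun hc => by
    rw [hc] at hj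
    simp at hj
  have hsub : {j ∈ (consRun f r).faulty | ¬ (consRun f r).Absent j} ⊆ r.faulty \ {j} := by
    rintro k ⟨hk, hka⟩
    refine ⟨consRun_faulty f r ▸ hk, ?_⟩
    rintro rfl
    exact hka (consRun_absent hj)
  have h1 := Set.ncard_le_ncard hsub (Set.toFinite _)
  rw [Set.ncard_sdiff_singleton_of_mem hjf] at h1
  have h2 : r.faulty.ncard ≤ f := hr
  omega

/-- A decision in Stealth is either a commit at time 3 or that of the embedded consensus run. -/
theorem decides_cases {C : Protocol n M Bool} (hn : 0 < n) {i : Fin n} {d : ACDecision}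
    (h : (stealth f C).Decides r i d) :
    (((3 : ℕ) : ℕ∞) ≤ r.crashTime i ∧ ¬ ErrReaches f r i ∧ d = .commit) ∨
      ((4 : ℕ∞) ≤ r.crashTime i ∧ ErrReaches f r i ∧
        ∃ b, C.Decides (consRun f r) i b ∧ d = ofBool b) := by
  obtain ⟨m, h⟩ := h
  obtain ⟨hm, ⟨rfl, he, hd⟩ | ⟨k, b, rfl, -, he, hd, hb⟩⟩ := (decidesAt_iff f C r hn i m d).1 h
  · exact .inl ⟨hm, he, hd⟩
  · have h4 : (4 : ℕ∞) ≤ r.crashTime i := le_trans (by exact_mod_cast Nat.le_add_left 4 k) hm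
    refine .inr ⟨h4, he, b, ⟨k, le_consRun_crashTime hm, ?_⟩, hd⟩
    rwa [← consHistory_eq C hn (huhReaches_of_errReaches h4 he)]

theorem consRun_inContext (hf : 1 ≤ f) (hr : r.InContext f) :
    (consRun f r).InContext (f - 1 + 1) := by
  rw [Nat.sub_add_cancel hf, Run.InContext, consRun_faulty]
  exact hr

theorem init_of_decides_commit {C : Protocol n M Bool} (hC : SolvesB1Consensus C (f - 1))
    (hf : 1 ≤ f) (hfn : f < n) (hr : r.InContext f) {i : Fin n}
    (h : (stealth f C).Decides r i .commit) (j : Fin n) : r.init j = true := by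
  rcases decides_cases (by omega) h with ⟨-, he, -⟩ | ⟨-, -, b, hb, hd⟩
  · obtain ⟨k, -, hk⟩ := exists_allOneReaches_of_not_errReaches hfn hr he
    exact hk.init j
  · cases b with
    | false => cases hd
    | true =>
      obtain ⟨k, hk⟩ := hC.validity _ (consRun_inContext hf hr) i true hb
      exact init_of_entryValue hfn hr hk j

/-- No process commits in a run in which another aborts. -/
theorem not_decides_commit_and_abort {C : Protocol n M Bool}
    (hC : SolvesB1Consensus C (f - 1)) (hf : 1 ≤ f) (hfn : f < n) (hr : r.InContext f)
    {i j : Fin n} (hi : (stealth f C).Decides r i .commit)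
    (hj : (stealth f C).Decides r j .abort) : False := by
  have hn : 0 < n := by omega
  have hv := init_of_decides_commit hC hf hfn hr hi
  rcases decides_cases hn hj with ⟨-, -, hd⟩ | ⟨-, he, b, hb, hd⟩
  · cases hd
  cases b with
  | true => cases hd
  | false =>
    have hctx := consRun_inContext hf hr
    have hcard := ncard_participating_faulty_le hn hr hv he
    rcases decides_cases hn hi with ⟨-, hei, -⟩ | ⟨-, -, b, hbi, hd⟩
    -- The process that commits at time 3 may crash before the consensus; the bias needs a correct
    -- proposer, hence `k`.
    · obtain ⟨k, hkc, hk⟩ := exists_allOneReaches_of_not_errReaches hfn hr hei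
      have := hC.biased_to_one _ hctx hcard
        ⟨k, (consRun_correct_iff f r k).2 hkc, by simp [consRun, entryValue, hk]⟩ j false hb
      cases this
    · cases b with
      | false => cases hd
      | true => cases hC.agreement _ hctx hcard i j _ _ hbi hb

theorem solvesAC {C : Protocol n M Bool} (hC : SolvesB1Consensus C (f - 1)) (hf : 1 ≤ f)
    (hfn : f < n) : SolvesAC (stealth f C) f where
  decision r hr i hi := by
    have hn : 0 < n := by omega
    by_cases he : ErrReaches f r i
    · have hhuh := huhReaches_of_errReaches (hi.le_crashTime 4) he
      obtain ⟨b, m, hb⟩ := hC.decision _ (consRun_inContext hf hr) i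
        ((consRun_correct_iff f r i).2 hi)
      refine ⟨ofBool b, m + 4, (decidesAt_iff f C r hn ..).2 ⟨hi.le_crashTime _, .inr
        ⟨m, b, rfl, hhuh i, he, rfl, ?_⟩⟩⟩
      rw [consHistory_eq C hn hhuh]
      exact hb.2
    · exact ⟨.commit, 3, (decidesAt_iff f C r hn ..).2
        ⟨hi.le_crashTime 3, .inl ⟨rfl, he, rfl⟩⟩⟩
  agreement r hr i j d d' h h' := by
    cases d <;> cases d'
    · rfl
    · exact (not_decides_commit_and_abort hC hf hfn hr h h').elim
    · exact (not_decides_commit_and_abort hC hf hfn hr h' h).elim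
    · rfl
  commit_validity r hr i h := init_of_decides_commit hC hf hfn hr h
  abort_validity r hr i h := by
    have hn : 0 < n := by omega
    by_contra! hc
    rcases decides_cases hn h with ⟨-, -, hd⟩ | ⟨-, ⟨k, -, hk, hA⟩, -⟩
    · cases hd
    · exact hA ⟨⟨0, hn⟩, rfl, (hc.2 _).transmits 1 k, fun l => ⟨(hc.2 l).transmits 0 _,
        by simpa using hc.1 l⟩, hk⟩

end Correctness

/-! ### The cost of nice runs. -/

section NiceRuns

variable {f : ℕ} {r : Run n}

theorem allOneReaches_of_isNice (hn : 0 < n) (hr : r.IsNice) {i : Fin n} (hi : (i : ℕ) ≤ f) :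
    AllOneReaches f r i :=
  ⟨⟨0, hn⟩, rfl, (hr.2 _).transmits 1 i, fun k => ⟨(hr.2 k).transmits 0 _, hr.1 k⟩, hi⟩

theorem not_errReaches_of_isNice (hn : 0 < n) (hr : r.IsNice) (i : Fin n) :
    ¬ ErrReaches f r i := by
  rintro ⟨k, -, hk, h⟩
  exact h (allOneReaches_of_isNice hn hr hk)

theorem decidesAt_iff_of_isNice (C : Protocol n M Bool) (hn : 0 < n) (hr : r.IsNice)
    (i : Fin n) (m : ℕ) (d : ACDecision) :
    (stealth f C).DecidesAt r i m d ↔ m = 3 ∧ d = .commit := by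
  rw [decidesAt_iff f C r hn]
  simp [not_errReaches_of_isNice hn hr, (hr.2 i).le_crashTime m]

theorem networkMessages_of_isNice (C : Protocol n M Bool) (hfn : f < n) (hr : r.IsNice) :
    (stealth f C).networkMessages r =
      ({(0 : ℕ)} ×ˢ {(⟨0, by omega⟩ : Fin n)}ᶜ ×ˢ {(⟨0, by omega⟩ : Fin n)}) ∪
      ({(1 : ℕ)} ×ˢ {(⟨0, by omega⟩ : Fin n)} ×ˢ Set.Ioc (⟨0, by omega⟩ : Fin n) ⟨f, hfn⟩) := by
  classical
  have hn : 0 < n := by omega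
  have herr := not_errReaches_of_isNice (f := f) hn hr
  have hhuh : ∀ i, ¬ HuhReaches f r i := fun i ⟨k, _, hk⟩ => herr k hk
  ext ⟨m, i, j⟩
  simp only [Protocol.networkMessages, Set.mem_ofPred_eq, Set.mem_union, Set.mem_prod,
    Set.mem_singleton_iff, Set.mem_compl_iff, Set.mem_Ioc, Fin.ext_iff, Fin.lt_def, Fin.le_def,
    (hr.2 i).transmits, true_and, ne_eq]
  rcases m with _ | _ | _ | _ | m
  · rw [send_zero]
    simp [hr.1 i]
    omega
  · rw [send_one]
    simp [hr.1, (hr.2 _).transmits]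
    omega
  · rw [send_two f C r hn, if_neg fun h => h.2 (allOneReaches_of_isNice hn hr h.1)]
    simp
  · rw [send_three f C r hn, if_neg (herr i)]
    simp
  · rw [send_add_four f C r hn, if_neg (hhuh i)]
    simp

theorem encard_networkMessages_of_isNice (C : Protocol n M Bool) (hfn : f < n)
    (hr : r.IsNice) :
    ((stealth f C).networkMessages r).encard = ((n + f - 1 : ℕ) : ℕ∞) := by
  classical
  rw [networkMessages_of_isNice C hfn hr, Set.encard_union_eq, Set.encard_prod, Set.encard_prod,
    Set.encard_prod, Set.encard_prod]
  · have h1 : ({(⟨0, by omega⟩ : Fin n)}ᶜ : Set (Fin n)).encard = ((n - 1 : ℕ) : ℕ∞) := by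
      rw [← Finset.coe_singleton, ← Finset.coe_compl, Set.encard_coe_eq_coe_finsetCard,
        Finset.card_compl, Finset.card_singleton, Fintype.card_fin]
    have h2 : (Set.Ioc (⟨0, by omega⟩ : Fin n) ⟨f, hfn⟩).encard = (f : ℕ∞) := by
      rw [← Finset.coe_Ioc, Set.encard_coe_eq_coe_finsetCard, Fin.card_Ioc]
      simp
    simp only [Set.encard_singleton, h1, h2, one_mul, mul_one]
    rw [← Nat.cast_add]
    congr 1
    omega
  · rw [Set.disjoint_left]
    rintro ⟨m, i, j⟩ ⟨h, -⟩ ⟨h', -⟩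
    simp only [Set.mem_singleton_iff] at h h'
    omega

end NiceRuns

end Stealth

/-! ### Lower bound: indistinguishable scenarios. -/

namespace Protocol

variable {n : ℕ} {M : Type*}

/-- The process `j` together with those to which it sends a message in round 1, if `v_j = 1`. -/
def firstReach {D : Type*} (P : Protocol n M D) (j : Fin n) : Set (Fin n) :=
  {k | k = j ∨ P.send j true [] k ≠ none}

theorem self_mem_firstReach {D : Type*} (P : Protocol n M D) (j : Fin n) :
    j ∈ P.firstReach j := Or.inl rfl

end Protocol

namespace Run

variable {n : ℕ}

open Classical in
/-- The run in which `j` has the initial value `v` and all others have the value `1`, where `j`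
crashes at time `c`, the other members of `S` crash at time `1`, reaching those in `R`, and `i`
crashes silently at time `e`. -/
noncomputable def scenario (j i : Fin n) (S R : Set (Fin n)) (v : Bool) (c e : ℕ∞) : Run n where
  init k := if k = j then v else true
  crashTime k := if k = j then c else if k ∈ S then 1 else if k = i then e else ⊤
  reach k := if k = i then ∅ else R

variable {j i : Fin n} {S R : Set (Fin n)} {v : Bool} {c e : ℕ∞}

theorem faulty_scenario_subset (hj : j ∈ S) : (scenario j i S R v c e).faulty ⊆ insert i S := by
  intro k hk
  by_contra h
  simp only [Set.mem_insert_iff, not_or] at h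
  have hkj : k ≠ j := fun hkj => h.2 (hkj ▸ hj)
  exact hk (by simp [Correct, scenario, hkj, h.1, h.2])

/-- When `i` stays correct it costs no failure; this is why `lt_ncard_firstReach` gains one over
`le_ncard_firstReach`. -/
theorem faulty_scenario_top_subset (hj : j ∈ S) : (scenario j i S R v c ⊤).faulty ⊆ S := by
  intro k hk
  by_contra h
  have hkj : k ≠ j := fun hkj => h (hkj ▸ hj)
  exact hk (by simp [Correct, scenario, hkj, h])

end Run

namespace Protocol

variable {n : ℕ} {M : Type*} {P : Protocol n M ACDecision} {f : ℕ} {r : Run n}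

open Run

/-- If `j` crashes silently at the start, those that it does not reach in the first round of the
nice run see no difference in that round. -/
theorem history_one_scenario (hr : r.IsNice) {j i k : Fin n} {S : Set (Fin n)} {v : Bool}
    {e : ℕ∞} (he : 2 ≤ e) (hk : k ∉ P.firstReach j) :
    P.history (scenario j i S ∅ v 0 e) 1 k = P.history r 1 k := by
  have he0 : e ≠ 0 := by rintro rfl; simp at he
  refine history_succ_congr P rfl fun a => ?_
  by_cases ha : a = j
  · subst ha
    rw [delivered_of_not_transmits P (by simp [Transmits, scenario]),
      delivered_of_transmits P ((hr.2 a).transmits 0 k), hr.1]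
    simp only [firstReach, Set.mem_ofPred_eq, not_or, not_not] at hk
    exact hk.2.symm
  · refine delivered_congr P (iff_of_true (.inl ?_) ((hr.2 a).transmits 0 k)) ?_ rfl
    · simp only [scenario, ha, if_false]
      split_ifs <;> simp [pos_iff_ne_zero, he0]
    · simp [scenario, ha, hr.1]

theorem commit_of_isNice (hP : SolvesAC P f) (hr : r.IsNice) {i : Fin n} {m : ℕ} {d : ACDecision}
    (h : P.DecidesAt r i m d) : d = .commit := by
  cases d with
  | commit => rfl
  | abort =>
    have hc : r.InContext f := by
      have : r.faulty = ∅ := Set.eq_empty_of_forall_notMem fun i hi => hi (hr.2 i)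
      simp [InContext, this]
    rcases hP.abort_validity r hc i ⟨m, h⟩ with ⟨j, hj⟩ | ⟨j, hj⟩
    · simp [hr.1] at hj
    · exact absurd (hr.2 j) hj

/-- If, in the nice run, no message that depends on `j` reaches `i` within two rounds and `i`
decides by then, then more than `f` processes are reached by `j` in the first round. -/
theorem lt_ncard_firstReach (hP : SolvesAC P f) (hr : r.IsNice) {i j : Fin n}
    (hi : ∃ m ≤ 2, ∃ d, P.DecidesAt r i m d) (hij : i ∉ P.firstReach j)
    (hsend : ∀ k ∈ P.firstReach j, P.send k true (P.history r 1 k) i = none) :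
    f < (P.firstReach j).ncard := by
  by_contra! hle
  obtain ⟨m, hm, d, hd⟩ := hi
  obtain rfl := commit_of_isNice hP hr hd
  -- All that could know of `j` die silently after round 1, so `i` takes the run for the nice one
  -- and commits although `v_j = 0`.
  set s := scenario j i (P.firstReach j) ∅ false 0 ⊤ with hs
  have hctx : s.InContext f :=
    (Set.ncard_le_ncard (faulty_scenario_top_subset (P.self_mem_firstReach j))
      (Set.toFinite _)).trans hle
  have hne : i ≠ j := fun h => hij (.inl h)
  have hist : P.history s 2 i = P.history r 2 i := by
    have h1 : ∀ k ∉ P.firstReach j, P.history s 1 k = P.history r 1 k := fun k hk =>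
      history_one_scenario hr le_top hk
    refine history_succ_congr P (h1 i hij) fun k => ?_
    by_cases hk : k ∈ P.firstReach j
    · rw [delivered_of_transmits P ((hr.2 k).transmits 1 i), hr.1, hsend k hk,
        delivered_of_not_transmits]
      by_cases hkj : k = j <;> simp [Transmits, hs, scenario, hk, hkj]
    · have hkj : k ≠ j := fun h => hk (.inl h)
      exact delivered_congr P (iff_of_true (.inl (by simp [hs, scenario, hk, hkj]))
        ((hr.2 k).transmits 1 i)) (by simp [hs, scenario, hkj, hr.1]) (h1 k hk)
  have hdec : P.Decides s i .commit := by
    refine ⟨m, by simp [hs, scenario, hij, hne], ?_⟩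
    rw [history_eq_of_le P hm hist, ← hd.2, hr.1]
    simp [hs, scenario, hne]
  simpa [hs, scenario] using hP.commit_validity s hctx i hdec j

/-- If `i` decides within two rounds of the nice run and is not reached by `j` in the first round,
then `j` reaches at least `f - 1` others: otherwise `i` could decide and crash together with
all that were reached by `j`, and nobody would ever hear of `v_j`. -/
theorem le_ncard_firstReach (hP : SolvesAC P f) (hfn : f < n) (hr : r.IsNice) {i j : Fin n}
    (hi : ∃ m ≤ 2, ∃ d, P.DecidesAt r i m d) (hij : i ∉ P.firstReach j) :
    f ≤ (P.firstReach j).ncard := by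
  by_contra! hlt
  obtain ⟨m, hm, d, hd⟩ := hi
  obtain rfl := commit_of_isNice hP hr hd
  set S := P.firstReach j with hS
  have hne : i ≠ j := fun h => hij (.inl h)
  have hjS : j ∈ S := P.self_mem_firstReach j
  have hcard : (insert i S).ncard ≤ f := (Set.ncard_insert_le i S).trans hlt
  -- In `a`, `i` sees a nice run up to time 2, commits, and dies before sending what it learnt in
  -- round 2. In `b`, `v_j = 0` and `j` is silent throughout. The survivors cannot tell the two
  -- apart.
  set a := scenario j i S {i} true 1 2 with ha
  set b := scenario j i S ∅ false 0 2 with hb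
  have hactx : a.InContext f :=
    (Set.ncard_le_ncard (faulty_scenario_subset hjS) (Set.toFinite _)).trans hcard
  have hbctx : b.InContext f :=
    (Set.ncard_le_ncard (faulty_scenario_subset hjS) (Set.toFinite _)).trans hcard
  have hinit : ∀ k, a.init k = r.init k := fun k => by simp [ha, scenario, hr.1]
  have hist : P.history a 2 i = P.history r 2 i := by
    have h1 : ∀ k, P.history a 1 k = P.history r 1 k := fun k =>
      history_succ_congr P rfl fun l => delivered_congr P (iff_of_true (.inl (by
        simp only [ha, scenario]
        split_ifs <;> simp)) ((hr.2 l).transmits 0 k)) (hinit l) rfl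
    refine history_succ_congr P (h1 i) fun k => ?_
    refine delivered_congr P (iff_of_true ?_ ((hr.2 k).transmits 1 i)) (hinit k) (h1 k)
    by_cases hkS : k ∈ S
    · have hki : k ≠ i := fun h => hij (h ▸ hkS)
      refine .inr ⟨?_, by simp [ha, scenario, hki]⟩
      by_cases hkj : k = j <;> simp [ha, scenario, hkS, hkj]
    · have hkj : k ≠ j := fun h => hkS (h ▸ hjS)
      refine .inl ?_
      by_cases hki : k = i <;> simp [ha, scenario, hkS, hkj, hki, hij, hne]
  have hdec : P.Decides a i .commit := by
    refine ⟨m, ?_, ?_⟩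
    · simpa [ha, scenario, hij, hne] using (by exact_mod_cast hm : (m : ℕ∞) ≤ 2)
    · rw [history_eq_of_le P hm hist, ← hd.2, hinit]
  obtain ⟨p, hp⟩ : ∃ p, p ∉ insert i S := by
    by_contra! h
    rw [Set.eq_univ_of_forall h, Set.ncard_univ, Nat.card_fin] at hcard
    omega
  simp only [Set.mem_insert_iff, not_or] at hp
  have hpj : p ≠ j := fun h => hp.2 (h ▸ hjS)
  -- `i` is excepted from time 2 on: in round 2 it hears from `S` in `a` but not in `b`.
  have key : ∀ m, ∀ p ∉ S, (p ≠ i ∨ m ≤ 1) → P.history a m p = P.history b m p := by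
    intro m
    induction m with
    | zero => exact fun _ _ _ => rfl
    | succ m ih =>
      intro p hpS hpi
      refine history_succ_congr P (ih p hpS (by omega)) fun k => ?_
      by_cases hkj : k = j
      · rw [delivered_of_not_transmits P (r := b) (by simp [hb, hkj, Transmits, scenario])]
        rcases Nat.eq_zero_or_pos m with rfl | hm0
        · subst hkj
          rw [delivered_of_transmits P (.inl (by simp [ha, scenario])), hinit, hr.1]
          simp only [hS, firstReach, Set.mem_ofPred_eq, not_or, not_not] at hpS
          exact hpS.2
        · refine delivered_of_not_transmits P ?_
          have : p ≠ i := by omega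
          simp [ha, hkj, Transmits, scenario, this, hne.symm]
          omega
      have hinit' : a.init k = b.init k := by simp [ha, hb, scenario, hkj]
      by_cases hkS : k ∈ S
      · have hki : k ≠ i := fun h => hij (h ▸ hkS)
        rcases Nat.eq_zero_or_pos m with rfl | hm0
        · exact delivered_congr P (iff_of_true (.inl (by simp [ha, scenario, hkS, hkj]))
            (.inl (by simp [hb, scenario, hkS, hkj]))) hinit' rfl
        · have : p ≠ i := by omega
          have hm1 : m ≠ 0 := by omega
          rw [delivered_of_not_transmits, delivered_of_not_transmits] <;>
            simp [ha, hb, Transmits, scenario, hkj, hkS, hki, this, hm1]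
      · have ht : a.Transmits k m p ↔ b.Transmits k m p := by
          by_cases hki : k = i <;> simp [ha, hb, Transmits, scenario, hkj, hkS, hki, hij, hne]
        -- Exactly when the state of `i` may differ, `i` is silent in both runs.
        by_cases hki : k = i ∧ 2 ≤ m
        · have : ¬ b.Transmits k m p := by
            simp [hb, Transmits, scenario, hki.1, hij, hne]
            omega
          rw [delivered_of_not_transmits P this, delivered_of_not_transmits P (mt ht.1 this)]
        · exact delivered_congr P ht hinit' (ih k hkS (by omega))
  have hpc : a.Correct p := by simp [Correct, ha, scenario, hp.1, hp.2, hpj]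
  obtain ⟨d, m', hpd⟩ := hP.decision a hactx p hpc
  obtain rfl := hP.agreement a hactx i p _ _ hdec ⟨m', hpd⟩
  have hpb : P.Decides b p .commit := by
    refine ⟨m', by simp [hb, scenario, hp.1, hp.2, hpj], ?_⟩
    rw [← key m' p hp.2 (.inl hp.1), ← hpd.2]
    simp [ha, hb, scenario, hpj]
  simpa [hb, scenario] using hP.commit_validity b hbctx p hpb j

/-! ### Lower bound: counting messages. -/

open Classical in
/-- The receivers of the messages that `j` sends over the network in round 1, if `v_j = 1`. -/
noncomputable def firstTargets (P : Protocol n M ACDecision) (j : Fin n) : Finset (Fin n) :=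
  Finset.univ.filter fun k => k ≠ j ∧ P.send j true [] k ≠ none

theorem mem_firstTargets {j k : Fin n} :
    k ∈ P.firstTargets j ↔ k ≠ j ∧ P.send j true [] k ≠ none := by
  simp [firstTargets]

theorem ncard_firstReach (j : Fin n) :
    (P.firstReach j).ncard = (P.firstTargets j).card + 1 := by
  classical
  have : P.firstReach j = ↑(insert j (P.firstTargets j)) := by
    ext k
    by_cases h : k = j <;> simp [firstReach, mem_firstTargets, h]
  rw [this, Set.ncard_coe_finset, Finset.card_insert_of_notMem (by simp [mem_firstTargets])]

/-- In a nice run the first-round messages are exactly those prescribed for value `1`, and they are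
disjoint from the round-2 messages in `G`. -/
theorem sum_card_firstTargets_add_le (hr : r.IsNice) {N : ℕ}
    (hN : (P.networkMessages r).encard = N) (G : Finset (Fin n × Fin n))
    (hG : ∀ x ∈ G, (1, x) ∈ P.networkMessages r) :
    ∑ j, (P.firstTargets j).card + G.card ≤ N := by
  classical
  let F : Finset (ℕ × Fin n × Fin n) := (Finset.univ.sigma fun j => P.firstTargets j).map
    ⟨fun x => (0, x.1, x.2), by rintro ⟨a, b⟩ ⟨c, d⟩ h; simp at h; simp [h]⟩
  let G' : Finset (ℕ × Fin n × Fin n) := G.map ⟨fun x => (1, x), by intro a b h; simpa using h⟩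
  have hdis : Disjoint F G' := by
    rw [Finset.disjoint_left]
    rintro x hx hx'
    simp only [F, G', Finset.mem_map] at hx hx'
    obtain ⟨y, -, rfl⟩ := hx
    obtain ⟨z, -, h⟩ := hx'
    exact absurd (congrArg Prod.fst h) one_ne_zero
  have hsub : ((F ∪ G' : Finset _) : Set (ℕ × Fin n × Fin n)) ⊆ P.networkMessages r := by
    intro x hx
    rcases Finset.mem_union.1 hx with hx | hx
    · simp only [F, Finset.mem_map] at hx
      obtain ⟨⟨j, k⟩, hy, rfl⟩ := hx
      have := mem_firstTargets.1 (Finset.mem_sigma.1 hy).2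
      refine ⟨this.1.symm, (hr.2 j).transmits 0 k, ?_⟩
      change P.send j (r.init j) [] k ≠ none
      rw [hr.1]
      exact this.2
    · simp only [G', Finset.mem_map] at hx
      obtain ⟨y, hy, rfl⟩ := hx
      exact hG y hy
  have h := Set.encard_le_encard hsub
  rw [hN, Set.encard_coe_eq_coe_finsetCard, Finset.card_union_of_disjoint hdis,
    Finset.card_map, Finset.card_map, Finset.card_sigma] at h
  exact_mod_cast h

/-- With `n + f - 1` messages in the nice run, two rounds are not enough. -/
theorem not_decide_in_two_rounds (hP : SolvesAC P f) (hn : 2 < n) (hf : 1 < f) (hfn : f < n)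
    (hr : r.IsNice) (hN : (P.networkMessages r).encard = ((n + f - 1 : ℕ) : ℕ∞))
    (hD : ∀ i, ∃ m ≤ 2, ∃ d, P.DecidesAt r i m d) : False := by
  have hlow : ∀ j, f ≤ (P.firstTargets j).card + 1 := by
    intro j
    rw [← ncard_firstReach]
    by_cases h : ∃ i, i ∉ P.firstReach j
    · obtain ⟨i, hi⟩ := h
      exact le_ncard_firstReach hP hfn hr (hD i) hi
    · push Not at h
      rw [Set.eq_univ_of_forall h, Set.ncard_univ, Nat.card_fin]
      omega
  have hsum0 := sum_card_firstTargets_add_le hr hN ∅ (by simp)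
  have hge : ∀ c, (∀ j, c ≤ (P.firstTargets j).card) →
      n * c ≤ ∑ j, (P.firstTargets j).card := fun c hc => by
    simpa using Finset.card_nsmul_le_sum Finset.univ _ c fun j _ => hc j
  simp only [Finset.card_empty, add_zero] at hsum0
  -- For `f ≥ 3` everyone has two first-round targets, and `2 * n ≤ n + f - 1` contradicts `f < n`.
  obtain rfl : f = 2 := by
    by_contra hf2
    have := hge 2 fun j => by have := hlow j; omega
    omega
  have hge1 := hge 1 fun j => by have := hlow j; omega
  -- At most one message is left for round 2. If it exists and goes to `l`, all have exactly one
  -- target; taking `j = l` makes `i ≠ l`, so nothing is sent to `i` in round 2. An `i` exists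
  -- because `j` reaches at most two of the `n > 2` processes.
  obtain ⟨j, i, hj, hij, hsend⟩ : ∃ j i, (P.firstTargets j).card ≤ 1 ∧ i ∉ P.firstReach j ∧
      ∀ k, (1, k, i) ∉ P.networkMessages r := by
    have hex : ∀ j, (P.firstTargets j).card ≤ 1 → ∃ i, i ∉ P.firstReach j := by
      intro j hj
      by_contra! h
      have := ncard_firstReach (P := P) j
      rw [Set.eq_univ_of_forall h, Set.ncard_univ, Nat.card_fin] at this
      omega
    by_cases h : ∃ k l, (1, k, l) ∈ P.networkMessages r
    · obtain ⟨k, l, hkl⟩ := h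
      have h1 := sum_card_firstTargets_add_le hr hN {(k, l)} (by simpa using hkl)
      have hl : (P.firstTargets l).card ≤ 1 := by
        by_contra! hl
        have : ∑ j : Fin n, 1 < ∑ j, (P.firstTargets j).card :=
          Finset.sum_lt_sum (fun j _ => by have := hlow j; omega) ⟨l, Finset.mem_univ l, hl⟩
        simp at this h1
        omega
      obtain ⟨i, hi⟩ := hex l hl
      refine ⟨l, i, hl, hi, fun k' hk' => ?_⟩
      have hne : (k, l) ≠ (k', i) := by
        rintro h
        simp only [Prod.mk.injEq] at h
        exact hi (.inl h.2.symm)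
      have h2 := sum_card_firstTargets_add_le hr hN {(k, l), (k', i)} (by
        intro x hx
        simp only [Finset.mem_insert, Finset.mem_singleton] at hx
        rcases hx with rfl | rfl
        exacts [hkl, hk'])
      rw [Finset.card_pair hne] at h2
      omega
    · push Not at h
      have : ∃ j, (P.firstTargets j).card ≤ 1 := by
        by_contra! hc
        have := hge 2 hc
        omega
      obtain ⟨j, hj⟩ := this
      obtain ⟨i, hi⟩ := hex j hj
      exact ⟨j, i, hj, hi, fun k => h k i⟩
  have := lt_ncard_firstReach hP hr (hD i) hij fun k hk => by
    by_contra hc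
    exact hsend k ⟨fun h : k = i => hij (h ▸ hk), (hr.2 k).transmits 1 i, by rwa [hr.1]⟩
  rw [ncard_firstReach] at this
  omega

end Protocol

theorem mainTheorem3 (n f : ℕ) (hn : 2 < n) (hf : 1 ≤ f) (hfn : f < n) :
    -- a suitable consensus protocol exists, even one that runs for only `f` rounds
    (∃ (M : Type) (C : Protocol n M Bool), SolvesB1Consensus C (f - 1) ∧
      ∀ r : Run n, r.InContext f → ∀ i, r.Correct i → ∃ m ≤ f, ∃ d, C.DecidesAt r i m d) ∧
    -- with any such protocol, Stealth solves AC, at the stated cost in nice runs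
    (∀ (M : Type*) (C : Protocol n M Bool), SolvesB1Consensus C (f - 1) →
      SolvesAC (stealth f C) f ∧
      ∀ r : Run n, r.IsNice →
        ((stealth f C).networkMessages r).encard = ((n + f - 1 : ℕ) : ℕ∞) ∧
        ∀ i m d, (stealth f C).DecidesAt r i m d ↔ m = 3 ∧ d = ACDecision.commit) ∧
    -- the matching lower bound
    (1 < f → ∀ (M : Type*) (P : Protocol n M ACDecision), SolvesAC P f →
      ∀ r : Run n, r.IsNice → (P.networkMessages r).encard = ((n + f - 1 : ℕ) : ℕ∞) →
        ∀ D : ℕ, (∀ i, ∃ m ≤ D, ∃ d, P.DecidesAt r i m d) → 3 ≤ D) := by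
  refine ⟨⟨Unit, Flooding.protocol n f, Flooding.solvesB1Consensus hf,
    fun r _ i hi => Flooding.exists_decidesAt f hi⟩, ?_, ?_⟩
  · exact fun M C hC => ⟨Stealth.solvesAC hC hf hfn, fun r hr =>
      ⟨Stealth.encard_networkMessages_of_isNice C hfn hr,
        Stealth.decidesAt_iff_of_isNice C (by omega) hr⟩⟩
  · intro hf1 M P hP r hr hN D hD
    by_contra! hlt
    exact Protocol.not_decide_in_two_rounds hP hn hf1 hfn hr hN fun i =>
      (hD i).imp fun m hm => ⟨by omega, hm.2⟩
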